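/- **Setting.** Let $\mathcal X$ (contexts) and $\mathcal A$ (arms) be finite sets, let $\mathbf p=(\mathbf p_x)_{x\in\mathcal X}$ be a probability distribution on $\mathcal X$ with $\mathbf p_x>0$ for every $x$, and let $\Phi\in\mathbb R^{(\mathcal X\times\mathcal A)\times d}$ be a feature matrix whose rows $\phi(x,a)^\top$ span $\mathbb R^d$. A contextual bandit instance has a vector of mean rewards $\mu\in\mathbb R^{\mathcal X\times\mathcal A}$, which need not lie in the range of $\Phi$. For $x\in\mathcal X$, $a\in\mathcal A$ let $\mathcal R^x_a=\{\xi\in\mathbb R^{\mathcal X\times\mathcal A}:\xi_{x,a}>\xi_{x,b}\ \forall b\neq a\}$ and $\Theta^x_a=\{\theta\in\mathbb R^d:\Phi\theta\in\mathcal R^x_a\}$. For a sampling distribution $\alpha$ in the simplex over $\mathcal X\times\mathcal A$ with $\Lambda=\mathrm{diag}(\alpha)$ such that $\Phi^\top\Lambda\Phi$ is invertible, let $$\mathbf P^\Lambda(\xi)=\operatorname*{argmin}_{\theta}\ \sum_{x,a}\alpha(x,a)\,\bigl(\phi(x,a)^\top\theta-\xi_{x,a}\bigr)^2 .$$ Let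 $\mathcal C^x_a$ be the set of all $\xi\in\mathcal R^x_a$ such that $\mathbf P^\Lambda(\xi)\in\Theta^x_a$ for all such $\Lambda$, and let $\mathcal C^{\mathcal X}$ be the set of all $\xi$ which, for every $x\in\mathcal X$, belong to $\mathcal C^x_{\mathrm{OPT}(x)}$, where $\mathrm{OPT}(x)$ is the optimal arm of $\xi$ at $x$. A point $\mu$ is an interior point of $\mathcal C^{\mathcal X}$ if for some $\delta>0$ the cell $\mathbf 1_\delta(\mu)=\{\xi:|\xi_{x,a}-\mu_{x,a}|<\delta\ \forall x,a\}$ is contained in $\mathcal C^{\mathcal X}$. **Algorithm.** In every round $t=1,2,\dots$: a context $X_t\sim\mathbf p$ is drawn independently of the past; with $\hat\theta_t$ any minimizer of $\sum_{s=1}^{t-1}(\phi(X_s,A_s)^\top\theta-Y_s)^2$ over $\theta\in\mathbb R^d$ (computed from the past), the arm $A_t$ is, conditionally on the past and $X_t$, with probability $1-\epsilon_t$ a maximizer of $a\mapsto\phi(X_t,a)^\top\hat\theta_t$ (ties broken arbitrarily), and with probability $\epsilon_t$ uniformly distributed on $\mathcal A$; then the reward $Y_t=\mu_{X_t,A_t}+\eta_t$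 is observed, where the noise is $\tfrac12$-sub-Gaussian: conditionally on the past, $X_t$ and $A_t$, $\mathbb E[e^{\lambda\eta_t}\mid\cdot\,]\le e^{\lambda^2/8}$ for all $\lambda\in\mathbb R$. **Theorem.** Let $\mu$ be an interior point of $\mathcal C^{\mathcal X}$. Then the $\epsilon$-greedy algorithm with $\epsilon_t=1/\sqrt t$ has expected regret $O(\Delta_{\max}\sqrt T)$: for every $\delta>0$ with $\mathbf 1_\delta(\mu)\subset\mathcal C^{\mathcal X}$ and all $T\ge 0$, $$\sum_{t=1}^T\mathbb E\bigl[\Delta_{X_t,A_t}\bigr]\ \le\ C\,\Delta_{\max}\sqrt T,$$ where $\Delta_{x,a}=\max_b\mu_{x,b}-\mu_{x,a}$, $\Delta_{\max}=\max_{x,a}\Delta_{x,a}$, and the constant $C$ depends only on $\mathcal X$, $\mathcal A$, $\mathbf p$ and $\delta$ (and not on $d$, $\Phi$, $\mu$ beyond $\delta$, the reward distributions, or $T$). -/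

import Mathlib

open MeasureTheory ProbabilityTheory
open scoped Matrix

noncomputable section

namespace ContextBandit

/-! ### Mean rewards, greedy regions and robust regions

`𝒳` is the finite set of contexts and `𝒜` the finite set of arms. A feature matrix has one row
for every context-arm pair, and a vector of mean rewards is a function on context-arm pairs. -/

section Regions

variable {𝒳 𝒜 : Type*} {d : ℕ}

/-- The reward vectors for which `a` is the (strictly) optimal arm in context `x`. -/
def greedyRegion (x : 𝒳) (a : 𝒜) : Set (𝒳 × 𝒜 → ℝ) :=
  {ξ | ∀ b, b ≠ a → ξ (x, b) < ξ (x, a)}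

/-- The parameters `θ` whose expressed rewards `Φ θ` make `a` the optimal arm in context `x`. -/
def robustParameterRegion (Φ : Matrix (𝒳 × 𝒜) (Fin d) ℝ) (x : 𝒳) (a : 𝒜) :
    Set (Fin d → ℝ) :=
  {θ | Φ *ᵥ θ ∈ greedyRegion x a}

variable [Fintype 𝒳] [Fintype 𝒜]

/-- `θ` is a model estimate of `ξ` under the weights `α`: it minimizes the `α`-weighted Euclidean
norm of `Φ θ - ξ` (equivalently, the square of that norm). -/
def IsModelEstimate (Φ : Matrix (𝒳 × 𝒜) (Fin d) ℝ) (α ξ : 𝒳 × 𝒜 → ℝ) (θ : Fin d → ℝ) : Prop :=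
  ∀ θ' : Fin d → ℝ,
    ∑ i, α i * ((Φ *ᵥ θ) i - ξ i) ^ 2 ≤ ∑ i, α i * ((Φ *ᵥ θ') i - ξ i) ^ 2

variable [DecidableEq 𝒳] [DecidableEq 𝒜]

/-- The robust observation region of arm `a` at context `x`: arm `a` is optimal at `x`, and for
every sampling distribution `α` with `Φᵀ diag(α) Φ` invertible the model estimate (unique in that
case) lies in the robust parameter region. -/
def robustObservationRegion (Φ : Matrix (𝒳 × 𝒜) (Fin d) ℝ) (x : 𝒳) (a : 𝒜) :
    Set (𝒳 × 𝒜 → ℝ) :=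
  {ξ | ξ ∈ greedyRegion x a ∧
    ∀ α ∈ stdSimplex ℝ (𝒳 × 𝒜), IsUnit (Φᵀ * Matrix.diagonal α * Φ) →
      ∀ θ, IsModelEstimate Φ α ξ θ → θ ∈ robustParameterRegion Φ x a}

/-- The region `C^𝒳 = ⋂ x, C^x_{OPT(x)}`, where `OPT(x)` is the optimal arm of the instance at
context `x`. As `C^x_a` only contains instances whose unique optimal arm at `x` is `a`, this is
membership in `C^x_a` for some arm `a`, for every context `x`. -/
def robustRegion (Φ : Matrix (𝒳 × 𝒜) (Fin d) ℝ) : Set (𝒳 × 𝒜 → ℝ) :=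
  ⋂ x, ⋃ a, robustObservationRegion Φ x a

/-- The open cell of size `δ` centred at `ξ`. -/
def cell (ξ : 𝒳 × 𝒜 → ℝ) (δ : ℝ) : Set (𝒳 × 𝒜 → ℝ) :=
  {ζ | ∀ i, ζ i ∈ Set.Ioo (ξ i - δ) (ξ i + δ)}

/-- The interior points of the robust region. -/
def robustInterior (Φ : Matrix (𝒳 × 𝒜) (Fin d) ℝ) : Set (𝒳 × 𝒜 → ℝ) :=
  {ξ | ∃ δ, 0 < δ ∧ cell ξ δ ⊆ robustRegion Φ}

end Regions

/-! ### Regret -/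

section Regret

variable {𝒳 𝒜 Ω : Type*}

/-- The sub-optimality gap of arm `a` in context `x`. -/
def gap (μ : 𝒳 × 𝒜 → ℝ) (x : 𝒳) (a : 𝒜) : ℝ := (⨆ b, μ (x, b)) - μ (x, a)

/-- The largest sub-optimality gap. -/
def maxGap (μ : 𝒳 × 𝒜 → ℝ) : ℝ := ⨆ i : 𝒳 × 𝒜, gap μ i.1 i.2

/-- The expected cumulative regret over the rounds `1, …, T`. -/
def regret [MeasurableSpace Ω] (P : Measure Ω) (μ : 𝒳 × 𝒜 → ℝ)
    (X : ℕ → Ω → 𝒳) (A : ℕ → Ω → 𝒜) (T : ℕ) : ℝ :=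
  ∑ t ∈ Finset.Icc 1 T, ∫ ω, gap μ (X t ω) (A t ω) ∂P

end Regret

/-! ### The interaction of the `ε`-greedy algorithm with a contextual bandit -/

section Interaction

variable {𝒳 𝒜 Ω : Type*} [MeasurableSpace 𝒳] [MeasurableSpace 𝒜] [mΩ : MeasurableSpace Ω]

/-- The information before the arm of round `n + 1` is drawn: the past and the new context. -/
abbrev infoBeforeAction (ℱ : Filtration ℕ mΩ) (X : ℕ → Ω → 𝒳) (n : ℕ) : MeasurableSpace Ω :=
  ℱ n ⊔ MeasurableSpace.comap (X (n + 1)) inferInstance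

/-- The information before the reward of round `n + 1` is drawn: the past, the new context and
the arm that is played. -/
abbrev infoBeforeReward (ℱ : Filtration ℕ mΩ) (X : ℕ → Ω → 𝒳) (A : ℕ → Ω → 𝒜) (n : ℕ) :
    MeasurableSpace Ω :=
  infoBeforeAction ℱ X n ⊔ MeasurableSpace.comap (A (n + 1)) inferInstance

/-- `η` is conditionally `R`-sub-Gaussian (hence conditionally centred) given `m`. -/
def IsCondSubGaussian (P : Measure Ω) (m : MeasurableSpace Ω) (η : Ω → ℝ) (R : ℝ) : Prop :=
  ∀ l : ℝ, Integrable (fun ω => Real.exp (l * η ω)) P ∧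
    ∀ᵐ ω ∂P, (P[fun ω' => Real.exp (l * η ω') | m]) ω ≤ Real.exp (l ^ 2 * R ^ 2 / 2)

variable [Fintype 𝒜] [DecidableEq 𝒜] {d : ℕ}

/-- The processes `X` (contexts), `A` (arms), `Y` (rewards), `θ` (least-squares estimates) and `G`
(greedy arms) form a run of the `ε`-greedy algorithm with exploration probabilities `ε` on a
contextual bandit with features `Φ`, mean rewards `μ`, context distribution `p` and
`R`-sub-Gaussian reward noise. The rounds are `1, 2, 3, …`, the index `0` of the processes is not
used, and `ℱ n` is the information after round `n`. -/
structure IsEpsGreedyRun (P : Measure Ω) (ℱ : Filtration ℕ mΩ)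
    (Φ : Matrix (𝒳 × 𝒜) (Fin d) ℝ) (μ : 𝒳 × 𝒜 → ℝ) (p : 𝒳 → ℝ) (R : ℝ) (ε : ℕ → ℝ)
    (X : ℕ → Ω → 𝒳) (A : ℕ → Ω → 𝒜) (Y : ℕ → Ω → ℝ)
    (θ : ℕ → Ω → (Fin d → ℝ)) (G : ℕ → Ω → 𝒜) : Prop where
  measurable_context : ∀ n, Measurable[ℱ (n + 1)] (X (n + 1))
  measurable_arm : ∀ n, Measurable[ℱ (n + 1)] (A (n + 1))
  measurable_reward : ∀ n, Measurable[ℱ (n + 1)] (Y (n + 1))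
  measurable_estimate : ∀ n, Measurable[ℱ n] (θ (n + 1))
  measurable_greedy : ∀ n, Measurable[infoBeforeAction ℱ X n] (G (n + 1))
  /-- The context of a round is independent of the past. -/
  context_indep : ∀ n, Indep (MeasurableSpace.comap (X (n + 1)) inferInstance) (ℱ n) P
  /-- The context of a round has distribution `p`. -/
  context_law : ∀ n x, P.real (X (n + 1) ⁻¹' {x}) = p x
  /-- The estimate used in round `n + 1` is a least-squares fit to the first `n` rounds (any
  minimizer, if there are several). -/
  estimate : ∀ n, ∀ᵐ ω ∂P, ∀ θ' : Fin d → ℝ,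
    ∑ s ∈ Finset.Icc 1 n, ((Φ *ᵥ θ (n + 1) ω) (X s ω, A s ω) - Y s ω) ^ 2 ≤
      ∑ s ∈ Finset.Icc 1 n, ((Φ *ᵥ θ') (X s ω, A s ω) - Y s ω) ^ 2
  /-- The greedy arm maximizes the estimated reward in the current context (ties are broken
  arbitrarily). -/
  greedy : ∀ n, ∀ᵐ ω ∂P, ∀ b,
    (Φ *ᵥ θ (n + 1) ω) (X (n + 1) ω, b) ≤ (Φ *ᵥ θ (n + 1) ω) (X (n + 1) ω, G (n + 1) ω)
  /-- Given the past and the current context, the greedy arm is played with probability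
  `1 - ε (n + 1)` and a uniformly random arm with probability `ε (n + 1)`. -/
  arm_law : ∀ n a, ∀ᵐ ω ∂P,
    (P⟦A (n + 1) ⁻¹' {a} | infoBeforeAction ℱ X n⟧) ω =
      (1 - ε (n + 1)) * (if G (n + 1) ω = a then 1 else 0) + ε (n + 1) / Fintype.card 𝒜
  /-- Given the past, the current context and the arm, the reward is the mean reward of the
  context-arm pair plus centred sub-Gaussian noise. -/
  reward_law : ∀ n, IsCondSubGaussian P (infoBeforeReward ℱ X A n)
    (fun ω => Y (n + 1) ω - μ (X (n + 1) ω, A (n + 1) ω)) R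

end Interaction

end ContextBandit

end

/-! Grouping the rounds by the observed context-arm pair shows, by Pythagoras, that the
least-squares estimate is the model estimate of the empirical means, weighted by the empirical
frequencies. Suppose that every pair has been observed and has an empirical mean within `δ` of the
true one. The empirical means then lie in the cell of `μ`. The cell is connected and the greedy
regions are open and pairwise disjoint, so the optimal arm is constant on it, and robustness makes
the least-squares estimate greedy for the optimal arm of `μ`, however the pairs were sampled.

It remains to bound the probability that a pair is observed too rarely or estimated inaccurately.
The deviation of its empirical mean is a sum of conditionally sub-Gaussian increments, nonzero only
when the pair is observed, which happens with conditional probability at least a multiple of `εₜ`.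
A penalty on every observation makes the exponential moment of the sum decay like `exp (-c ∑ εₛ)`,
a single Chernoff bound that covers both failures without a union over the number of observations.
For `εₜ = 1 / √t` this is `O(1 / √t)`, the order of the cost of exploration, and `∑ 1 / √t ≤ 2 √T`.
-/

namespace ContextBandit

section Conditioning

variable {Ω : Type*} {m m' mΩ : MeasurableSpace Ω} {P : Measure Ω}

theorem lintegral_mul_condLExp (hm : m ≤ mΩ) [SigmaFinite (P.trim hm)] {f g : Ω → ENNReal}
    (hf : Measurable[m] f) (hg : AEMeasurable g P) :
    ∫⁻ ω, f ω * (P⁻[g | m]) ω ∂P = ∫⁻ ω, f ω * g ω ∂P := by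
  have htrim : (P.withDensity P⁻[g | m]).trim hm = (P.withDensity g).trim hm := by
    refine @Measure.ext _ m _ _ fun s hs => ?_
    rw [trim_measurableSet_eq hm hs, trim_measurableSet_eq hm hs, withDensity_apply _ (hm s hs),
      withDensity_apply _ (hm s hs), setLIntegral_condLExp hm P g hs]
  have hf' : AEMeasurable f P := (hf.mono hm le_rfl).aemeasurable
  have hc : AEMeasurable P⁻[g | m] P := (measurable_condLExp' m P g).aemeasurable
  calc ∫⁻ ω, f ω * (P⁻[g | m]) ω ∂P = ∫⁻ ω, f ω ∂P.withDensity P⁻[g | m] := by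
        simp only [lintegral_withDensity_eq_lintegral_mul₀ hc hf', Pi.mul_apply, mul_comm]
    _ = ∫⁻ ω, f ω ∂P.withDensity g := by
        rw [← lintegral_trim hm hf, htrim, lintegral_trim hm hf]
    _ = ∫⁻ ω, f ω * g ω ∂P := by
        simp only [lintegral_withDensity_eq_lintegral_mul₀ hg hf', Pi.mul_apply, mul_comm]

theorem lintegral_mul_ofReal_le_of_condExp_le (hm : m ≤ mΩ) [SigmaFinite (P.trim hm)]
    {f : Ω → ENNReal} (hf : Measurable[m] f) {g : Ω → ℝ} (hg : Integrable g P) (hg0 : 0 ≤ᵐ[P] g)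
    {c : ℝ} (hc : ∀ᵐ ω ∂P, (P[g | m]) ω ≤ c) :
    ∫⁻ ω, f ω * ENNReal.ofReal (g ω) ∂P ≤ (∫⁻ ω, f ω ∂P) * ENNReal.ofReal c := by
  rw [← lintegral_mul_condLExp hm hf hg.aemeasurable.ennreal_ofReal,
    ← lintegral_mul_const' _ _ ENNReal.ofReal_ne_top]
  refine lintegral_mono_ae ?_
  filter_upwards [condLExp_ofReal m hg hg0, hc] with ω hω hcω
  rw [hω]
  gcongr

theorem mul_le_condExp_indicator [IsFiniteMeasure P] (hmm' : m ≤ m') (hm' : m' ≤ mΩ) {B : Set Ω}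
    (hB : MeasurableSet[m'] B) {h : Ω → ℝ} (hh : Integrable h P) {c q : ℝ} (hc0 : 0 ≤ c)
    (hc : ∀ᵐ ω ∂P, c ≤ (P[h | m']) ω) (hq : ∀ᵐ ω ∂P, q ≤ (P⟦B | m⟧) ω) :
    ∀ᵐ ω ∂P, c * q ≤ (P[B.indicator h | m]) ω := by
  have hconst : Integrable (B.indicator fun _ => (1 : ℝ)) P :=
    (integrable_const 1).indicator (hm' B hB)
  have hle : c • B.indicator (fun _ => (1 : ℝ)) ≤ᵐ[P] P[B.indicator h | m'] := by
    filter_upwards [condExp_indicator hh hB, hc] with ω hω hcω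
    rw [hω]
    by_cases hωB : ω ∈ B <;> simp [hωB, hcω]
  filter_upwards [condExp_mono (m := m) (hconst.smul c) integrable_condExp hle,
    condExp_smul c (B.indicator fun _ => (1 : ℝ)) m,
    condExp_condExp_of_le (f := B.indicator h) (μ := P) hmm' hm', hq] with ω hmono hsmul htower hqω
  rw [hsmul, htower, Pi.smul_apply, smul_eq_mul] at hmono
  exact (mul_le_mul_of_nonneg_left hqω hc0).trans hmono

theorem exp_indicator_eq_one_sub_indicator (B : Set Ω) (W : Ω → ℝ) :
    (fun ω => Real.exp (B.indicator W ω)) =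
      (fun _ => (1 : ℝ)) - B.indicator ((fun _ => (1 : ℝ)) - fun ω => Real.exp (W ω)) := by
  ext ω
  by_cases hω : ω ∈ B <;> simp [hω]

theorem integrable_exp_indicator [IsFiniteMeasure P] {B : Set Ω} (hB : MeasurableSet B)
    {W : Ω → ℝ} (hW : Integrable (fun ω => Real.exp (W ω)) P) :
    Integrable (fun ω => Real.exp (B.indicator W ω)) P := by
  rw [exp_indicator_eq_one_sub_indicator]
  exact (integrable_const 1).sub (((integrable_const 1).sub hW).indicator hB)

theorem condExp_exp_indicator_le [IsProbabilityMeasure P] (hmm' : m ≤ m') (hm' : m' ≤ mΩ)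
    {B : Set Ω} (hB : MeasurableSet[m'] B) {W : Ω → ℝ}
    (hW : Integrable (fun ω => Real.exp (W ω)) P) {b q : ℝ} (hb1 : b ≤ 1)
    (hb : ∀ᵐ ω ∂P, (P[fun ω => Real.exp (W ω) | m']) ω ≤ b)
    (hq : ∀ᵐ ω ∂P, q ≤ (P⟦B | m⟧) ω) :
    ∀ᵐ ω ∂P, (P[fun ω => Real.exp (B.indicator W ω) | m]) ω ≤ Real.exp (-((1 - b) * q)) := by
  have hloss : Integrable ((fun _ => (1 : ℝ)) - fun ω => Real.exp (W ω)) P :=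
    (integrable_const 1).sub hW
  have hb' : ∀ᵐ ω ∂P, 1 - b ≤ (P[(fun _ => (1 : ℝ)) - fun ω => Real.exp (W ω) | m']) ω := by
    filter_upwards [condExp_sub (integrable_const (1 : ℝ)) hW m', hb] with ω hsub hbω
    rw [hsub, Pi.sub_apply, condExp_const hm']
    linarith
  filter_upwards [mul_le_condExp_indicator hmm' hm' hB hloss (sub_nonneg.2 hb1) hb' hq,
    condExp_sub (integrable_const (1 : ℝ)) (hloss.indicator (hm' B hB)) m] with ω hgain hsub
  rw [exp_indicator_eq_one_sub_indicator, hsub, Pi.sub_apply, condExp_const (hmm'.trans hm')]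
  linarith [Real.add_one_le_exp (-((1 - b) * q))]

theorem measureReal_diff_le_of_le_condExp [IsFiniteMeasure P] (hm : m ≤ mΩ) {s B : Set Ω}
    (hs : MeasurableSet[m] s) (hB : MeasurableSet B) {c : ℝ}
    (hc : ∀ᵐ ω ∂P, ω ∈ s → c ≤ (P⟦B | m⟧) ω) :
    P.real (s \ B) ≤ (1 - c) * P.real s := by
  have hinter : c * P.real s ≤ P.real (s ∩ B) := by
    calc c * P.real s = ∫ _ in s, c ∂P := by rw [setIntegral_const, smul_eq_mul, mul_comm]
      _ ≤ ∫ ω in s, (P⟦B | m⟧) ω ∂P :=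
          setIntegral_mono_on_ae integrableOn_const integrable_condExp.integrableOn (hm s hs) hc
      _ = ∫ ω in s, B.indicator (fun _ => (1 : ℝ)) ω ∂P :=
          setIntegral_condExp hm ((integrable_const 1).indicator hB) hs
      _ = P.real (s ∩ B) := by
          rw [setIntegral_indicator hB, setIntegral_const, smul_eq_mul, mul_one]
  linarith [measureReal_inter_add_sdiff (μ := P) (s := s) hB]

section Chernoff

variable [IsProbabilityMeasure P] {ℱ : Filtration ℕ mΩ} {Z : ℕ → Ω → ℝ} {c : ℕ → ℝ}

theorem lintegral_exp_sum_le_of_condExp_exp_le (hZ : ∀ n, Measurable[ℱ (n + 1)] (Z (n + 1)))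
    (hint : ∀ n, Integrable (fun ω => Real.exp (Z (n + 1) ω)) P)
    (hc : ∀ n, ∀ᵐ ω ∂P, (P[fun ω => Real.exp (Z (n + 1) ω) | ℱ n]) ω ≤ Real.exp (-c (n + 1)))
    (n : ℕ) :
    ∫⁻ ω, ENNReal.ofReal (Real.exp (∑ s ∈ Finset.Icc 1 n, Z s ω)) ∂P ≤
      ENNReal.ofReal (Real.exp (-∑ s ∈ Finset.Icc 1 n, c s)) := by
  induction n with
  | zero => simp
  | succ n ih =>
    have hsum : Measurable[ℱ n] fun ω => ∑ s ∈ Finset.Icc 1 n, Z s ω :=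
      Finset.measurable_sum _ fun s hs => by
        obtain ⟨k, rfl⟩ := Nat.exists_eq_add_of_le' (Finset.mem_Icc.1 hs).1
        exact (hZ k).mono (ℱ.mono (Finset.mem_Icc.1 hs).2) le_rfl
    simp only [Finset.sum_Icc_succ_top (Nat.le_add_left 1 n), neg_add, Real.exp_add,
      ENNReal.ofReal_mul (Real.exp_pos _).le]
    exact (lintegral_mul_ofReal_le_of_condExp_le (ℱ.le n) hsum.exp.ennreal_ofReal (hint n)
      (.of_forall fun ω => (Real.exp_pos _).le) (hc n)).trans (mul_le_mul_left ih _)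

theorem measureReal_zero_le_sum_le_of_condExp_exp_le
    (hZ : ∀ n, Measurable[ℱ (n + 1)] (Z (n + 1)))
    (hint : ∀ n, Integrable (fun ω => Real.exp (Z (n + 1) ω)) P)
    (hc : ∀ n, ∀ᵐ ω ∂P, (P[fun ω => Real.exp (Z (n + 1) ω) | ℱ n]) ω ≤ Real.exp (-c (n + 1)))
    (n : ℕ) :
    P.real {ω | 0 ≤ ∑ s ∈ Finset.Icc 1 n, Z s ω} ≤ Real.exp (-∑ s ∈ Finset.Icc 1 n, c s) := by
  refine ENNReal.toReal_le_of_le_ofReal (Real.exp_pos _).le ?_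
  have hsum : Measurable fun ω => ∑ s ∈ Finset.Icc 1 n, Z s ω :=
    Finset.measurable_sum _ fun s hs => by
      obtain ⟨k, rfl⟩ := Nat.exists_eq_add_of_le' (Finset.mem_Icc.1 hs).1
      exact (hZ k).mono (ℱ.le _) le_rfl
  exact (meas_le_lintegral₀ hsum.exp.ennreal_ofReal.aemeasurable fun ω hω =>
    ENNReal.one_le_ofReal.2 (Real.one_le_exp hω)).trans
      (lintegral_exp_sum_le_of_condExp_exp_le hZ hint hc n)

end Chernoff

end Conditioning

section Sampling

open Finset

variable {κ ι : Type*}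

theorem sum_sq_sub_eq_card_mul_add (S : Finset κ) (y : κ → ℝ) (c : ℝ) :
    ∑ s ∈ S, (c - y s) ^ 2 =
      #S * (c - (∑ s ∈ S, y s) / #S) ^ 2 + ∑ s ∈ S, ((∑ s ∈ S, y s) / #S - y s) ^ 2 := by
  rcases S.eq_empty_or_nonempty with rfl | hS
  · simp
  · set ybar : ℝ := (∑ s ∈ S, y s) / #S
    have hcentered : ∑ s ∈ S, (ybar - y s) = 0 := by
      have hcard : (#S : ℝ) ≠ 0 := by exact_mod_cast hS.card_ne_zero
      rw [sum_sub_distrib, sum_const, nsmul_eq_mul, mul_div_cancel₀ _ hcard, sub_self]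
    calc ∑ s ∈ S, (c - y s) ^ 2
        = ∑ s ∈ S, ((c - ybar) ^ 2 + 2 * (c - ybar) * (ybar - y s) + (ybar - y s) ^ 2) :=
          sum_congr rfl fun s _ => by ring
      _ = #S * (c - ybar) ^ 2 + ∑ s ∈ S, (ybar - y s) ^ 2 := by
          rw [sum_add_distrib, sum_add_distrib, ← mul_sum, hcentered, sum_const, nsmul_eq_mul,
            mul_zero, add_zero]

variable [DecidableEq ι] (S : Finset κ) (I : κ → ι) (y : κ → ℝ)

/-- The average of the observations `y s`, `s ∈ S`, of the item `i`, where `I s` is the item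
observed at `s`; it is `0` if `i` is not observed. -/
noncomputable def empiricalMean (i : ι) : ℝ :=
  (∑ s ∈ S with I s = i, y s) / #{s ∈ S | I s = i}

/-- The proportion of the observations in `S` that concern the item `i`. It is the sampling
distribution for which least squares on the sample is a model estimate of the empirical means. -/
noncomputable def empiricalFrequency (i : ι) : ℝ := #{s ∈ S | I s = i} / #S

/-- The item `i` is observed in the sample `S`, and its empirical mean differs from `m i` by less
than `δ`. -/
def IsAccurate (m : ι → ℝ) (δ : ℝ) (i : ι) : Prop :=
  (∃ s ∈ S, I s = i) ∧ |empiricalMean S I y i - m i| < δ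

variable {S I y}

theorem mul_card_le_abs_sum_of_not_isAccurate {m : ι → ℝ} {δ : ℝ} {i : ι}
    (h : ¬ IsAccurate S I y m δ i) :
    δ * #{s ∈ S | I s = i} ≤ |∑ s ∈ S with I s = i, (y s - m i)| := by
  rcases ({s ∈ S | I s = i}).eq_empty_or_nonempty with hempty | hne
  · simp [hempty]
  · have hcard : (0 : ℝ) < #{s ∈ S | I s = i} := by exact_mod_cast hne.card_pos
    have hmean : empiricalMean S I y i - m i =
        (∑ s ∈ S with I s = i, (y s - m i)) / #{s ∈ S | I s = i} := by
      rw [empiricalMean, sum_sub_distrib, sum_const, nsmul_eq_mul]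
      field_simp
    have hfar : δ ≤ |empiricalMean S I y i - m i| :=
      not_lt.1 fun hlt => h ⟨filter_nonempty_iff.1 hne, hlt⟩
    rwa [hmean, abs_div, abs_of_pos hcard, le_div_iff₀ hcard] at hfar

/-- The deviation of the observation `y` of the item `j` from the mean `m i`, scaled by `l` and
reduced by the penalty `r`, or `0` if `j` is not the item `i`. Sums of penalized deviations are the
exponents to which the Chernoff bound is applied: through the penalty, every observation of `i`
lowers the exponential moment. -/
noncomputable def penalizedDeviation (m : ι → ℝ) (l r : ℝ) (i j : ι) (y : ℝ) : ℝ :=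
  if j = i then l * (y - m i) - r else 0

theorem sum_penalizedDeviation (m : ι → ℝ) (l r : ℝ) (i : ι) :
    ∑ s ∈ S, penalizedDeviation m l r i (I s) (y s) =
      l * ∑ s ∈ S with I s = i, (y s - m i) - r * #{s ∈ S | I s = i} := by
  simp only [penalizedDeviation]
  rw [← sum_filter, sum_sub_distrib, ← mul_sum, sum_const, nsmul_eq_mul, mul_comm r]

theorem sum_penalizedDeviation_nonneg_of_not_isAccurate {m : ι → ℝ} {δ l : ℝ} (hl : 0 ≤ l) {i : ι}
    (h : ¬ IsAccurate S I y m δ i) :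
    0 ≤ ∑ s ∈ S, penalizedDeviation m l (l * δ) i (I s) (y s) ∨
      0 ≤ ∑ s ∈ S, penalizedDeviation m (-l) (l * δ) i (I s) (y s) := by
  simp only [sum_penalizedDeviation, sub_nonneg, mul_assoc l δ, neg_mul_comm]
  exact (le_abs.1 (mul_card_le_abs_sum_of_not_isAccurate h)).imp
    (mul_le_mul_of_nonneg_left · hl) (mul_le_mul_of_nonneg_left · hl)

theorem empiricalFrequency_pos {i : ι} (h : ∃ s ∈ S, I s = i) : 0 < empiricalFrequency S I i := by
  have hi : 0 < #{s ∈ S | I s = i} := card_pos.2 (filter_nonempty_iff.2 h)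
  have hS : 0 < #S := hi.trans_le (card_filter_le _ _)
  exact div_pos (by exact_mod_cast hi) (by exact_mod_cast hS)

variable [Fintype ι]

theorem sum_empiricalFrequency (hS : S.Nonempty) : ∑ i, empiricalFrequency S I i = 1 := by
  have hcard : (#S : ℝ) ≠ 0 := by exact_mod_cast hS.card_ne_zero
  simp only [empiricalFrequency]
  rw [← sum_div, div_eq_one_iff_eq hcard]
  exact_mod_cast (card_eq_sum_card_fiberwise fun s _ => mem_univ (I s)).symm

theorem sum_sq_residual_eq (v : ι → ℝ) :
    ∑ s ∈ S, (v (I s) - y s) ^ 2 =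
      ∑ i, #{s ∈ S | I s = i} * (v i - empiricalMean S I y i) ^ 2 +
        ∑ s ∈ S, (empiricalMean S I y (I s) - y s) ^ 2 := by
  rw [← sum_fiberwise S I, ← sum_fiberwise S I fun s => (empiricalMean S I y (I s) - y s) ^ 2,
    ← sum_add_distrib]
  refine sum_congr rfl fun i _ => ?_
  have hconst (w : ι → ℝ) :
      ∑ s ∈ S with I s = i, (w (I s) - y s) ^ 2 = ∑ s ∈ S with I s = i, (w i - y s) ^ 2 :=
    sum_congr rfl fun s hs => by rw [(mem_filter.1 hs).2]
  rw [hconst v, hconst (empiricalMean S I y)]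
  exact sum_sq_sub_eq_card_mul_add _ y (v i)

end Sampling

section Sums

open Finset

theorem sqrt_le_sum_one_div_sqrt (n : ℕ) : √(n : ℝ) ≤ ∑ s ∈ Icc 1 n, 1 / √(s : ℝ) := by
  calc √(n : ℝ) = #(Icc 1 n) • (1 / √(n : ℝ)) := by
        rw [Nat.card_Icc, Nat.add_sub_cancel, nsmul_eq_mul, mul_one_div, Real.div_sqrt]
    _ ≤ ∑ s ∈ Icc 1 n, 1 / √(s : ℝ) := card_nsmul_le_sum _ _ _ fun s hs => by
        obtain ⟨hs1, hsn⟩ := mem_Icc.1 hs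
        have : 0 < √(s : ℝ) := Real.sqrt_pos.2 (Nat.cast_pos.2 hs1)
        gcongr

theorem sum_one_div_sqrt_le (n : ℕ) : ∑ s ∈ Icc 1 n, 1 / √(s : ℝ) ≤ 2 * √(n : ℝ) := by
  induction n with
  | zero => simp
  | succ n ih =>
    have hpos : 0 < √((n + 1 : ℕ) : ℝ) := Real.sqrt_pos.2 (by positivity)
    have hstep : 1 / √((n + 1 : ℕ) : ℝ) ≤ 2 * (√((n + 1 : ℕ) : ℝ) - √(n : ℝ)) := by
      have hsq := Real.sq_sqrt (Nat.cast_nonneg (α := ℝ) n)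
      have hsq' := Real.sq_sqrt (Nat.cast_nonneg (α := ℝ) (n + 1))
      rw [div_le_iff₀ hpos]
      push_cast at hsq' ⊢
      nlinarith [sq_nonneg (√((n : ℝ) + 1) - √(n : ℝ))]
    rw [sum_Icc_succ_top (Nat.le_add_left 1 n)]
    linarith

theorem exp_neg_mul_sum_one_div_sqrt_le {c : ℝ} (hc : 0 < c) (n : ℕ) :
    Real.exp (-(c * ∑ s ∈ Icc 1 n, 1 / √(s : ℝ))) ≤
      Real.exp c / c * (1 / √((n + 1 : ℕ) : ℝ)) := by
  have hsqrt : √((n + 1 : ℕ) : ℝ) ≤ ∑ s ∈ Icc 1 n, 1 / √(s : ℝ) + 1 := by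
    have hsucc : √((n + 1 : ℕ) : ℝ) ≤ √(n : ℝ) + 1 := by
      have hsq := Real.sq_sqrt (Nat.cast_nonneg (α := ℝ) n)
      refine Real.sqrt_le_iff.2 ⟨by positivity, ?_⟩
      push_cast
      nlinarith [Real.sqrt_nonneg (n : ℝ)]
    linarith [sqrt_le_sum_one_div_sqrt n]
  have hpos : 0 < c * √((n + 1 : ℕ) : ℝ) := mul_pos hc (Real.sqrt_pos.2 (by positivity))
  calc Real.exp (-(c * ∑ s ∈ Icc 1 n, 1 / √(s : ℝ)))
      ≤ Real.exp (c - c * √((n + 1 : ℕ) : ℝ)) := Real.exp_le_exp.2 (by nlinarith)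
    _ = Real.exp c / Real.exp (c * √((n + 1 : ℕ) : ℝ)) := Real.exp_sub _ _
    _ ≤ Real.exp c / (c * √((n + 1 : ℕ) : ℝ)) := by
        exact div_le_div_of_nonneg_left (Real.exp_pos _).le hpos
          ((le_add_of_nonneg_right zero_le_one).trans (Real.add_one_le_exp _))
    _ = Real.exp c / c * (1 / √((n + 1 : ℕ) : ℝ)) := by rw [div_mul_div_comm, mul_one]

end Sums

section Geometry

open Finset

theorem mulVec_injective_of_span_row_eq_top {m n K : Type*} [Fintype n] [CommRing K]
    {M : Matrix m n K} (hM : Submodule.span K (Set.range M.row) = ⊤) :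
    Function.Injective M.mulVec := by
  classical
  intro v w hvw
  have hdual : dotProductBilin K K v = dotProductBilin K K w := by
    refine LinearMap.ext_on hM ?_
    rintro _ ⟨i, rfl⟩
    rw [dotProductBilin_apply_apply, dotProductBilin_apply_apply, dotProduct_comm v,
      dotProduct_comm w]
    exact congr_fun hvw i
  exact dotProduct_eq v w fun u => LinearMap.congr_fun hdual u

theorem isUnit_transpose_mul_diagonal_mul {m n : Type*} [Fintype m] [DecidableEq m] [Fintype n]
    [DecidableEq n] {M : Matrix m n ℝ} (hM : Submodule.span ℝ (Set.range M.row) = ⊤)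
    {α : m → ℝ} (hα : ∀ i, 0 < α i) : IsUnit (Mᵀ * Matrix.diagonal α * M) := by
  rw [← Matrix.conjTranspose_eq_transpose_of_trivial]
  exact ((Matrix.PosDef.diagonal hα).conjTranspose_mul_mul_same
    (mulVec_injective_of_span_row_eq_top hM)).isUnit

variable {𝒳 𝒜 : Type*}

theorem disjoint_greedyRegion {x : 𝒳} {a b : 𝒜} (hab : a ≠ b) :
    Disjoint (greedyRegion x a) (greedyRegion x b) :=
  Set.disjoint_left.2 fun _ ha hb => (ha b hab.symm).asymm (hb a hab)

theorem isOpen_greedyRegion [Finite 𝒜] (x : 𝒳) (a : 𝒜) : IsOpen (greedyRegion x a) := by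
  simp only [greedyRegion, Set.ofPred_forall]
  exact isOpen_iInter_of_finite fun b => isOpen_iInter_of_finite fun _ =>
    isOpen_lt (continuous_apply _) (continuous_apply _)

theorem isPreconnected_cell (μ : 𝒳 × 𝒜 → ℝ) (δ : ℝ) : IsPreconnected (cell μ δ) := by
  have hbox : cell μ δ = Set.univ.pi fun i => Set.Ioo (μ i - δ) (μ i + δ) := by
    ext; simp only [cell, Set.mem_ofPred_eq, Set.mem_univ_pi]
  exact hbox ▸ (convex_pi fun i _ => convex_Ioo _ _).isPreconnected

theorem mem_cell_self (μ : 𝒳 × 𝒜 → ℝ) {δ : ℝ} (hδ : 0 < δ) : μ ∈ cell μ δ :=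
  fun i => ⟨sub_lt_self (μ i) hδ, lt_add_of_pos_right (μ i) hδ⟩

variable [Fintype 𝒳] [DecidableEq 𝒳] [Fintype 𝒜] [DecidableEq 𝒜] {d : ℕ}
  {Φ : Matrix (𝒳 × 𝒜) (Fin d) ℝ}

theorem exists_mem_robustObservationRegion {ξ : 𝒳 × 𝒜 → ℝ} (hξ : ξ ∈ robustRegion Φ) (x : 𝒳) :
    ∃ a, ξ ∈ robustObservationRegion Φ x a :=
  Set.mem_iUnion.1 (Set.mem_iInter.1 hξ x)

theorem subset_robustObservationRegion_of_isPreconnected {s : Set (𝒳 × 𝒜 → ℝ)}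
    (hs : IsPreconnected s) (hsΦ : s ⊆ robustRegion Φ) {μ : 𝒳 × 𝒜 → ℝ} (hμ : μ ∈ s) {x : 𝒳}
    {a : 𝒜} (ha : μ ∈ greedyRegion x a) : s ⊆ robustObservationRegion Φ x a := by
  have hgreedy : s ⊆ greedyRegion x a := by
    refine IsPreconnected.subset_left_of_subset_union (v := ⋃ b ≠ a, greedyRegion x b)
      (isOpen_greedyRegion x a) (isOpen_biUnion fun b _ => isOpen_greedyRegion x b)
      (Set.disjoint_iUnion₂_right.2 fun b hb => disjoint_greedyRegion hb.symm) ?_ ⟨μ, hμ, ha⟩ hs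
    intro ξ hξ
    obtain ⟨b, hb⟩ := exists_mem_robustObservationRegion (hsΦ hξ) x
    rcases eq_or_ne b a with rfl | hba
    · exact .inl hb.1
    · exact .inr (Set.mem_biUnion hba hb.1)
  intro ξ hξ
  obtain ⟨b, hb⟩ := exists_mem_robustObservationRegion (hsΦ hξ) x
  rcases eq_or_ne b a with rfl | hba
  · exact hb
  · exact ((disjoint_greedyRegion hba).notMem_of_mem_left hb.1 (hgreedy hξ)).elim

variable {κ : Type*} {S : Finset κ} {I : κ → 𝒳 × 𝒜} {y : κ → ℝ} {θ : Fin d → ℝ}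

theorem isModelEstimate_of_leastSquares
    (hθ : ∀ θ' : Fin d → ℝ, ∑ s ∈ S, ((Φ *ᵥ θ) (I s) - y s) ^ 2 ≤
      ∑ s ∈ S, ((Φ *ᵥ θ') (I s) - y s) ^ 2) :
    IsModelEstimate Φ (empiricalFrequency S I) (empiricalMean S I y) θ := by
  intro θ'
  have h := hθ θ'
  rw [sum_sq_residual_eq (Φ *ᵥ θ), sum_sq_residual_eq (Φ *ᵥ θ'), add_le_add_iff_right] at h
  simp only [empiricalFrequency, div_mul_eq_mul_div, ← sum_div]
  exact div_le_div_of_nonneg_right h (Nat.cast_nonneg _)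

theorem mem_robustParameterRegion_of_leastSquares
    (hΦ : Submodule.span ℝ (Set.range Φ.row) = ⊤) {μ : 𝒳 × 𝒜 → ℝ} {δ : ℝ}
    (hcell : cell μ δ ⊆ robustRegion Φ) {x : 𝒳} {a : 𝒜} (ha : μ ∈ greedyRegion x a)
    (hacc : ∀ i, IsAccurate S I y μ δ i)
    (hθ : ∀ θ' : Fin d → ℝ, ∑ s ∈ S, ((Φ *ᵥ θ) (I s) - y s) ^ 2 ≤
      ∑ s ∈ S, ((Φ *ᵥ θ') (I s) - y s) ^ 2) :
    θ ∈ robustParameterRegion Φ x a := by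
  have hδ : 0 < δ := (abs_nonneg _).trans_lt (hacc (x, a)).2
  have hS : S.Nonempty := (hacc (x, a)).1.imp fun _ hs => hs.1
  have hfreq (i : 𝒳 × 𝒜) : 0 < empiricalFrequency S I i := empiricalFrequency_pos (hacc i).1
  have hmean : empiricalMean S I y ∈ cell μ δ := fun i => by
    obtain ⟨hupper, hlower⟩ := abs_sub_lt_iff.1 (hacc i).2
    exact ⟨sub_lt_comm.1 hlower, sub_lt_iff_lt_add'.1 hupper⟩
  exact (subset_robustObservationRegion_of_isPreconnected (isPreconnected_cell μ δ) hcell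
    (mem_cell_self μ hδ) ha hmean).2 _
      ⟨fun i => (hfreq i).le, sum_empiricalFrequency hS⟩
      (isUnit_transpose_mul_diagonal_mul hΦ hfreq) θ (isModelEstimate_of_leastSquares hθ)

end Geometry

section Gap

variable {𝒳 𝒜 : Type*} [Finite 𝒜] (μ : 𝒳 × 𝒜 → ℝ)

theorem gap_nonneg (x : 𝒳) (a : 𝒜) : 0 ≤ gap μ x a :=
  sub_nonneg.2 (le_ciSup (f := fun b => μ (x, b)) (Set.finite_range _).bddAbove a)

theorem gap_le_maxGap [Finite 𝒳] (x : 𝒳) (a : 𝒜) : gap μ x a ≤ maxGap μ :=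
  le_ciSup (f := fun i : 𝒳 × 𝒜 => gap μ i.1 i.2) (Set.finite_range _).bddAbove (x, a)

theorem maxGap_nonneg : 0 ≤ maxGap μ :=
  Real.iSup_nonneg fun i => gap_nonneg μ i.1 i.2

variable {μ}

theorem gap_eq_zero_of_mem_greedyRegion {x : 𝒳} {a : 𝒜} (ha : μ ∈ greedyRegion x a) :
    gap μ x a = 0 := by
  have : Nonempty 𝒜 := ⟨a⟩
  refine le_antisymm (sub_nonpos.2 (ciSup_le fun b => ?_)) (gap_nonneg μ x a)
  rcases eq_or_ne b a with rfl | hb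
  · exact le_rfl
  · exact (ha b hb).le

theorem integral_gap_le_maxGap_mul_measureReal [Finite 𝒳] {Ω : Type*} {mΩ : MeasurableSpace Ω}
    {P : Measure Ω} [IsFiniteMeasure P] {X : Ω → 𝒳} {A : Ω → 𝒜} {o : 𝒳 → 𝒜}
    (ho : ∀ x, μ ∈ greedyRegion x (o x)) (hmeas : MeasurableSet {ω | A ω ≠ o (X ω)}) :
    ∫ ω, gap μ (X ω) (A ω) ∂P ≤ maxGap μ * P.real {ω | A ω ≠ o (X ω)} := by
  calc ∫ ω, gap μ (X ω) (A ω) ∂P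
      ≤ ∫ ω, {ω | A ω ≠ o (X ω)}.indicator (fun _ => maxGap μ) ω ∂P := by
        refine integral_mono_of_nonneg (.of_forall fun ω => gap_nonneg μ _ _)
          ((integrable_const _).indicator hmeas) (.of_forall fun ω => ?_)
        by_cases hω : A ω = o (X ω)
        · simp [hω, gap_eq_zero_of_mem_greedyRegion (ho _)]
        · simpa [hω] using gap_le_maxGap μ _ _
    _ = maxGap μ * P.real {ω | A ω ≠ o (X ω)} := by
        rw [integral_indicator_const _ hmeas, smul_eq_mul, mul_comm]

end Gap

section Run

open Finset

/-- The rate at which exploration makes the empirical mean of the pair `i` accurate to `δ`: per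
unit of exploration probability, `i` is observed with probability `p i.1 / card 𝒜`, and every
observation shrinks the exponential moment of the penalized deviation by the factor
`exp (-(δ² / (2 R²)))`. -/
noncomputable def concentrationRate {𝒳 𝒜 : Type*} [Fintype 𝒜] (p : 𝒳 → ℝ) (R δ : ℝ)
    (i : 𝒳 × 𝒜) : ℝ :=
  p i.1 / Fintype.card 𝒜 * (1 - Real.exp (-(δ ^ 2 / (2 * R ^ 2))))

theorem concentrationRate_pos {𝒳 𝒜 : Type*} [Fintype 𝒜] {p : 𝒳 → ℝ} {R δ : ℝ} {i : 𝒳 × 𝒜}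
    (hp : 0 < p i.1) (hR : R ≠ 0) (hδ : δ ≠ 0) : 0 < concentrationRate p R δ i := by
  have hcard : 0 < (Fintype.card 𝒜 : ℝ) := Nat.cast_pos.2 (Fintype.card_pos_iff.2 ⟨i.2⟩)
  have hexp : Real.exp (-(δ ^ 2 / (2 * R ^ 2))) < 1 :=
    Real.exp_lt_one_iff.2 (neg_lt_zero.2 (by positivity))
  exact mul_pos (div_pos hp hcard) (sub_pos.2 hexp)

/-- The factor by which the bound on the probability of a suboptimal arm in round `t` exceeds the
exploration probability `1 / √t`: exploration contributes `1`, and each of the two tails of the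
empirical mean of a pair with concentration rate `c` contributes `exp c / c`. -/
noncomputable def roundConstant {𝒳 : Type*} (𝒜 : Type*) [Fintype 𝒳] [Fintype 𝒜] (p : 𝒳 → ℝ)
    (R δ : ℝ) : ℝ :=
  1 + ∑ i : 𝒳 × 𝒜, 2 * (Real.exp (concentrationRate p R δ i) / concentrationRate p R δ i)

theorem roundConstant_nonneg {𝒳 𝒜 : Type*} [Fintype 𝒳] [Fintype 𝒜] {p : 𝒳 → ℝ} {R δ : ℝ}
    (hp : ∀ x, 0 < p x) (hR : R ≠ 0) (hδ : δ ≠ 0) : 0 ≤ roundConstant 𝒜 p R δ :=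
  add_nonneg zero_le_one (sum_nonneg fun i _ => mul_nonneg zero_le_two
    (div_nonneg (Real.exp_pos _).le (concentrationRate_pos (hp i.1) hR hδ).le))

theorem exp_penalizedDeviation_eq_exp_indicator {ι Ω : Type*} [DecidableEq ι] (m : ι → ℝ)
    (l r : ℝ) (i : ι) (I : Ω → ι) (y : Ω → ℝ) :
    (fun ω => Real.exp (penalizedDeviation m l r i (I ω) (y ω))) =
      fun ω => Real.exp ({ω | I ω = i}.indicator (fun ω => l * (y ω - m (I ω)) - r) ω) := by
  ext ω
  by_cases hω : I ω = i <;> simp [penalizedDeviation, hω]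

theorem measurableSet_infoBeforeReward_pair {𝒳 𝒜 Ω : Type*} [MeasurableSpace 𝒳]
    [MeasurableSingletonClass 𝒳] [MeasurableSpace 𝒜] [MeasurableSingletonClass 𝒜]
    {mΩ : MeasurableSpace Ω} (ℱ : Filtration ℕ mΩ) (X : ℕ → Ω → 𝒳) (A : ℕ → Ω → 𝒜) (n : ℕ)
    (i : 𝒳 × 𝒜) :
    MeasurableSet[infoBeforeReward ℱ X A n] {ω | (X (n + 1) ω, A (n + 1) ω) = i} := by
  have hX : Measurable[infoBeforeReward ℱ X A n] (X (n + 1)) :=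
    (comap_measurable _).mono (le_sup_right.trans le_sup_left) le_rfl
  have hA : Measurable[infoBeforeReward ℱ X A n] (A (n + 1)) :=
    (comap_measurable _).mono le_sup_right le_rfl
  exact (hX.prodMk hA) (measurableSet_singleton i)

variable {𝒳 𝒜 Ω : Type*} [MeasurableSpace 𝒳] [MeasurableSpace 𝒜] [Fintype 𝒜] [DecidableEq 𝒜]
  {d : ℕ} {mΩ : MeasurableSpace Ω} {P : Measure Ω} {ℱ : Filtration ℕ mΩ}
  {Φ : Matrix (𝒳 × 𝒜) (Fin d) ℝ} {μ : 𝒳 × 𝒜 → ℝ} {p : 𝒳 → ℝ} {R : ℝ} {ε : ℕ → ℝ}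
  {X : ℕ → Ω → 𝒳} {A : ℕ → Ω → 𝒜} {Y : ℕ → Ω → ℝ} {θ : ℕ → Ω → (Fin d → ℝ)} {G : ℕ → Ω → 𝒜}

namespace IsEpsGreedyRun

theorem infoBeforeReward_le (h : IsEpsGreedyRun P ℱ Φ μ p R ε X A Y θ G) (n : ℕ) :
    infoBeforeReward ℱ X A n ≤ ℱ (n + 1) :=
  sup_le (sup_le (ℱ.mono n.le_succ) (h.measurable_context n).comap_le)
    (h.measurable_arm n).comap_le

theorem infoBeforeAction_le (h : IsEpsGreedyRun P ℱ Φ μ p R ε X A Y θ G) (n : ℕ) :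
    infoBeforeAction ℱ X n ≤ ℱ (n + 1) :=
  le_sup_left.trans (h.infoBeforeReward_le n)

theorem measureReal_greedy_ne_le [Fintype 𝒳] [DecidableEq 𝒳] [IsFiniteMeasure P]
    (h : IsEpsGreedyRun P ℱ Φ μ p R ε X A Y θ G)
    (hΦ : Submodule.span ℝ (Set.range Φ.row) = ⊤) {δ : ℝ} (hcell : cell μ δ ⊆ robustRegion Φ)
    {o : 𝒳 → 𝒜} (ho : ∀ x, μ ∈ greedyRegion x (o x)) (n : ℕ) :
    P.real {ω | G (n + 1) ω ≠ o (X (n + 1) ω)} ≤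
      ∑ i, P.real {ω | ¬ IsAccurate (Icc 1 n) (fun s => (X s ω, A s ω)) (Y · ω) μ δ i} := by
  refine (ENNReal.toReal_mono (measure_ne_top _ _) (measure_mono_ae ?_)).trans
    (measureReal_iUnion_fintype_le _)
  filter_upwards [h.estimate n, h.greedy n] with ω hestimate hgreedy hne
  by_contra hbad
  have hacc (i) : IsAccurate (Icc 1 n) (fun s => (X s ω, A s ω)) (Y · ω) μ δ i :=
    not_not.1 fun hi => hbad (Set.mem_iUnion.2 ⟨i, hi⟩)
  have hopt := mem_robustParameterRegion_of_leastSquares hΦ hcell (ho (X (n + 1) ω)) hacc hestimate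
  exact (hopt _ hne).not_ge (hgreedy (o (X (n + 1) ω)))

section Exploration

variable [MeasurableSingletonClass 𝒜]

theorem measurableSet_arm (h : IsEpsGreedyRun P ℱ Φ μ p R ε X A Y θ G) (n : ℕ) (a : 𝒜) :
    MeasurableSet (A (n + 1) ⁻¹' {a}) :=
  ℱ.le _ _ (h.measurable_arm n (measurableSet_singleton a))

theorem measureReal_arm_ne_greedy_le [IsProbabilityMeasure P]
    (h : IsEpsGreedyRun P ℱ Φ μ p R ε X A Y θ G) {n : ℕ} (hε0 : 0 ≤ ε (n + 1)) :
    P.real {ω | A (n + 1) ω ≠ G (n + 1) ω} ≤ ε (n + 1) := by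
  have hm : infoBeforeAction ℱ X n ≤ mΩ := (h.infoBeforeAction_le n).trans (ℱ.le _)
  have hG (a : 𝒜) : MeasurableSet[infoBeforeAction ℱ X n] (G (n + 1) ⁻¹' {a}) :=
    h.measurable_greedy n (measurableSet_singleton a)
  have hdiff (a : 𝒜) : P.real (G (n + 1) ⁻¹' {a} \ A (n + 1) ⁻¹' {a}) ≤
      ε (n + 1) * P.real (G (n + 1) ⁻¹' {a}) := by
    refine sub_sub_cancel 1 (ε (n + 1)) ▸
       measureReal_diff_le_of_le_condExp hm (hG a) (h.measurableSet_arm n a) ?_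
    filter_upwards [h.arm_law n a] with ω hlaw (hω : G (n + 1) ω = a)
    rw [hlaw, if_pos hω, mul_one]
    exact le_add_of_nonneg_right (div_nonneg hε0 (Nat.cast_nonneg _))
  calc P.real {ω | A (n + 1) ω ≠ G (n + 1) ω}
      ≤ P.real (⋃ a, G (n + 1) ⁻¹' {a} \ A (n + 1) ⁻¹' {a}) :=
        measureReal_mono fun ω hω => Set.mem_iUnion.2 ⟨G (n + 1) ω, rfl, hω⟩
    _ ≤ ∑ a, P.real (G (n + 1) ⁻¹' {a} \ A (n + 1) ⁻¹' {a}) := measureReal_iUnion_fintype_le _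
    _ ≤ ∑ a, ε (n + 1) * P.real (G (n + 1) ⁻¹' {a}) := sum_le_sum fun a _ => hdiff a
    _ = ε (n + 1) := by
        rw [← mul_sum, sum_measureReal_preimage_singleton _ fun a _ => hm _ (hG a), coe_univ,
          Set.preimage_univ, probReal_univ, mul_one]

variable [MeasurableSingletonClass 𝒳]

theorem le_condExp_pair [IsProbabilityMeasure P] (h : IsEpsGreedyRun P ℱ Φ μ p R ε X A Y θ G)
    {n : ℕ} (hε0 : 0 ≤ ε (n + 1)) (hε1 : ε (n + 1) ≤ 1) (i : 𝒳 × 𝒜) :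
    ∀ᵐ ω ∂P, ε (n + 1) / Fintype.card 𝒜 * p i.1 ≤
      (P⟦{ω | (X (n + 1) ω, A (n + 1) ω) = i} | ℱ n⟧) ω := by
  have hm : infoBeforeAction ℱ X n ≤ mΩ := (h.infoBeforeAction_le n).trans (ℱ.le _)
  have hXle : MeasurableSpace.comap (X (n + 1)) inferInstance ≤ infoBeforeAction ℱ X n :=
    le_sup_right
  have hX : MeasurableSet[MeasurableSpace.comap (X (n + 1)) inferInstance]
      (X (n + 1) ⁻¹' {i.1}) := ⟨{i.1}, measurableSet_singleton _, rfl⟩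
  have harm : ∀ᵐ ω ∂P, ε (n + 1) / Fintype.card 𝒜 ≤
      (P⟦A (n + 1) ⁻¹' {i.2} | infoBeforeAction ℱ X n⟧) ω := by
    filter_upwards [h.arm_law n i.2] with ω hlaw
    rw [hlaw]
    exact le_add_of_nonneg_left (mul_nonneg (sub_nonneg.2 hε1) (by split_ifs <;> norm_num))
  have hcontext : ∀ᵐ ω ∂P, p i.1 ≤ (P⟦X (n + 1) ⁻¹' {i.1} | ℱ n⟧) ω := by
    filter_upwards [condExp_indep_eq (hXle.trans hm) (ℱ.le n)
      ((stronglyMeasurable_const (b := (1 : ℝ))).indicator hX) (h.context_indep n)] with ω hω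
    rw [hω, integral_indicator_const _ (hm _ (hXle _ hX)), h.context_law, smul_eq_mul,
      mul_one]
  have hpair : {ω | (X (n + 1) ω, A (n + 1) ω) = i}.indicator (fun _ => (1 : ℝ)) =
      (X (n + 1) ⁻¹' {i.1}).indicator ((A (n + 1) ⁻¹' {i.2}).indicator fun _ => 1) := by
    rw [Set.indicator_indicator]
    congr 1
    ext ω
    exact Prod.ext_iff
  rw [hpair]
  exact mul_le_condExp_indicator le_sup_left hm (hXle _ hX)
    ((integrable_const 1).indicator (h.measurableSet_arm n i.2))
    (div_nonneg hε0 (Nat.cast_nonneg _)) harm hcontext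

end Exploration

theorem integrable_exp_mul_noise_sub (h : IsEpsGreedyRun P ℱ Φ μ p R ε X A Y θ G) (l r : ℝ)
    (n : ℕ) :
    Integrable (fun ω => Real.exp (l * (Y (n + 1) ω - μ (X (n + 1) ω, A (n + 1) ω)) - r)) P := by
  simp only [Real.exp_sub _ r]
  exact (h.reward_law n l).1.div_const _

theorem condExp_exp_mul_noise_sub_le (h : IsEpsGreedyRun P ℱ Φ μ p R ε X A Y θ G) (l r : ℝ)
    (n : ℕ) :
    ∀ᵐ ω ∂P, (P[fun ω => Real.exp (l * (Y (n + 1) ω - μ (X (n + 1) ω, A (n + 1) ω)) - r) |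
      infoBeforeReward ℱ X A n]) ω ≤ Real.exp (l ^ 2 * R ^ 2 / 2 - r) := by
  have hscale : (fun ω => Real.exp (l * (Y (n + 1) ω - μ (X (n + 1) ω, A (n + 1) ω)) - r)) =
      Real.exp (-r) • fun ω => Real.exp (l * (Y (n + 1) ω - μ (X (n + 1) ω, A (n + 1) ω))) := by
    ext ω
    rw [Pi.smul_apply, smul_eq_mul, ← Real.exp_add, neg_add_eq_sub]
  rw [hscale, ← neg_add_eq_sub r, Real.exp_add]
  filter_upwards [condExp_smul (μ := P) (Real.exp (-r))
    (fun ω => Real.exp (l * (Y (n + 1) ω - μ (X (n + 1) ω, A (n + 1) ω))))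
    (infoBeforeReward ℱ X A n), (h.reward_law n l).2] with ω hsmul hnoise
  rw [hsmul, Pi.smul_apply, smul_eq_mul]
  exact mul_le_mul_of_nonneg_left hnoise (Real.exp_pos _).le

section Concentration

variable [MeasurableSingletonClass 𝒳] [MeasurableSingletonClass 𝒜]

variable [DecidableEq 𝒳]

theorem measurable_penalizedDeviation (h : IsEpsGreedyRun P ℱ Φ μ p R ε X A Y θ G) (l r : ℝ)
    (i : 𝒳 × 𝒜) (n : ℕ) :
    Measurable[ℱ (n + 1)] fun ω =>
      penalizedDeviation μ l r i (X (n + 1) ω, A (n + 1) ω) (Y (n + 1) ω) := by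
  have hpair : MeasurableSet[ℱ (n + 1)] {ω | (X (n + 1) ω, A (n + 1) ω) = i} :=
    h.infoBeforeReward_le n _ (measurableSet_infoBeforeReward_pair ℱ X A n i)
  exact Measurable.ite hpair ((((h.measurable_reward n).sub_const _).const_mul _).sub_const _)
    measurable_const

theorem integrable_exp_penalizedDeviation [IsFiniteMeasure P]
    (h : IsEpsGreedyRun P ℱ Φ μ p R ε X A Y θ G) (l r : ℝ) (i : 𝒳 × 𝒜) (n : ℕ) :
    Integrable (fun ω => Real.exp
      (penalizedDeviation μ l r i (X (n + 1) ω, A (n + 1) ω) (Y (n + 1) ω))) P := by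
  rw [exp_penalizedDeviation_eq_exp_indicator μ l r i fun ω => (X (n + 1) ω, A (n + 1) ω)]
  exact integrable_exp_indicator
    (ℱ.le _ _ (h.infoBeforeReward_le n _ (measurableSet_infoBeforeReward_pair ℱ X A n i)))
    (h.integrable_exp_mul_noise_sub l r n)

variable [IsProbabilityMeasure P]

theorem condExp_exp_penalizedDeviation_le (h : IsEpsGreedyRun P ℱ Φ μ p R ε X A Y θ G) {n : ℕ}
    (hε0 : 0 ≤ ε (n + 1)) (hε1 : ε (n + 1) ≤ 1) {l r : ℝ} (hr : l ^ 2 * R ^ 2 / 2 ≤ r)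
    (i : 𝒳 × 𝒜) :
    ∀ᵐ ω ∂P, (P[fun ω => Real.exp
      (penalizedDeviation μ l r i (X (n + 1) ω, A (n + 1) ω) (Y (n + 1) ω)) | ℱ n]) ω ≤
      Real.exp (-((1 - Real.exp (l ^ 2 * R ^ 2 / 2 - r)) *
        (ε (n + 1) / Fintype.card 𝒜 * p i.1))) := by
  rw [exp_penalizedDeviation_eq_exp_indicator μ l r i fun ω => (X (n + 1) ω, A (n + 1) ω)]
  exact condExp_exp_indicator_le (le_sup_left.trans le_sup_left)
    ((h.infoBeforeReward_le n).trans (ℱ.le _)) (measurableSet_infoBeforeReward_pair ℱ X A n i)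
    (h.integrable_exp_mul_noise_sub l r n) (Real.exp_le_one_iff.2 (sub_nonpos.2 hr))
    (h.condExp_exp_mul_noise_sub_le l r n) (h.le_condExp_pair hε0 hε1 i)

theorem measureReal_zero_le_sum_penalizedDeviation_le
    (h : IsEpsGreedyRun P ℱ Φ μ p R ε X A Y θ G) (hε0 : ∀ n, 0 ≤ ε (n + 1))
    (hε1 : ∀ n, ε (n + 1) ≤ 1) {l r : ℝ} (hr : l ^ 2 * R ^ 2 / 2 ≤ r) (i : 𝒳 × 𝒜) (n : ℕ) :
    P.real {ω | 0 ≤ ∑ s ∈ Icc 1 n, penalizedDeviation μ l r i (X s ω, A s ω) (Y s ω)} ≤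
      Real.exp (-(p i.1 / Fintype.card 𝒜 * (1 - Real.exp (l ^ 2 * R ^ 2 / 2 - r)) *
        ∑ s ∈ Icc 1 n, ε s)) := by
  have hbound := measureReal_zero_le_sum_le_of_condExp_exp_le (P := P) (ℱ := ℱ)
    (Z := fun s ω => penalizedDeviation μ l r i (X s ω, A s ω) (Y s ω))
    (h.measurable_penalizedDeviation l r i) (h.integrable_exp_penalizedDeviation l r i)
    (c := fun s => (1 - Real.exp (l ^ 2 * R ^ 2 / 2 - r)) * (ε s / Fintype.card 𝒜 * p i.1))
    (fun k => h.condExp_exp_penalizedDeviation_le (hε0 k) (hε1 k) hr i) n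
  rw [← mul_sum, ← sum_mul, ← sum_div] at hbound
  convert hbound using 3
  ring

theorem measureReal_not_isAccurate_le (h : IsEpsGreedyRun P ℱ Φ μ p R ε X A Y θ G)
    (hε0 : ∀ n, 0 ≤ ε (n + 1)) (hε1 : ∀ n, ε (n + 1) ≤ 1) (hR : R ≠ 0) {δ : ℝ} (hδ : 0 < δ)
    (i : 𝒳 × 𝒜) (n : ℕ) :
    P.real {ω | ¬ IsAccurate (Icc 1 n) (fun s => (X s ω, A s ω)) (Y · ω) μ δ i} ≤
      2 * Real.exp (-(concentrationRate p R δ i * ∑ s ∈ Icc 1 n, ε s)) := by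
  -- The slope `δ / R²` minimizes the exponent `l² R² / 2 - l δ`.
  set l : ℝ := δ / R ^ 2 with hl
  have hl0 : 0 ≤ l := by positivity
  have hexponent (k : ℝ) (hk : k ^ 2 = l ^ 2) :
      k ^ 2 * R ^ 2 / 2 - l * δ = -(δ ^ 2 / (2 * R ^ 2)) := by
    rw [hk, hl]
    field_simp
    ring
  have htail (k : ℝ) (hk : k ^ 2 = l ^ 2) :
      P.real {ω | 0 ≤ ∑ s ∈ Icc 1 n,
        penalizedDeviation μ k (l * δ) i (X s ω, A s ω) (Y s ω)} ≤
      Real.exp (-(concentrationRate p R δ i * ∑ s ∈ Icc 1 n, ε s)) := by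
    have hk0 : k ^ 2 * R ^ 2 / 2 - l * δ ≤ 0 := by
      rw [hexponent k hk]
      exact neg_nonpos.2 (by positivity)
    rw [concentrationRate, ← hexponent k hk]
    exact h.measureReal_zero_le_sum_penalizedDeviation_le hε0 hε1 (sub_nonpos.1 hk0) i n
  rw [two_mul]
  exact (measureReal_mono fun ω hω =>
    sum_penalizedDeviation_nonneg_of_not_isAccurate hl0 hω).trans
      ((measureReal_union_le _ _).trans (add_le_add (htail l rfl) (htail (-l) (neg_sq l))))

theorem integral_gap_le [Fintype 𝒳] (h : IsEpsGreedyRun P ℱ Φ μ p R ε X A Y θ G)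
    (hΦ : Submodule.span ℝ (Set.range Φ.row) = ⊤) {δ : ℝ} (hδ : 0 < δ)
    (hcell : cell μ δ ⊆ robustRegion Φ) (hε0 : ∀ n, 0 ≤ ε (n + 1)) (hε1 : ∀ n, ε (n + 1) ≤ 1)
    (hR : R ≠ 0) (n : ℕ) :
    ∫ ω, gap μ (X (n + 1) ω) (A (n + 1) ω) ∂P ≤ maxGap μ * (ε (n + 1) +
      ∑ i : 𝒳 × 𝒜, 2 * Real.exp (-(concentrationRate p R δ i * ∑ s ∈ Icc 1 n, ε s))) := by
  have hopt (x : 𝒳) : ∃ a, μ ∈ robustObservationRegion Φ x a :=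
    exists_mem_robustObservationRegion (hcell (mem_cell_self μ hδ)) x
  choose o ho using hopt
  have hmeas : MeasurableSet {ω | A (n + 1) ω ≠ o (X (n + 1) ω)} :=
    (measurableSet_eq_fun ((h.measurable_arm n).mono (ℱ.le _) le_rfl)
      (Measurable.of_discrete.comp ((h.measurable_context n).mono (ℱ.le _) le_rfl))).compl
  refine (integral_gap_le_maxGap_mul_measureReal (fun x => (ho x).1) hmeas).trans
    (mul_le_mul_of_nonneg_left ?_ (maxGap_nonneg μ))
  calc P.real {ω | A (n + 1) ω ≠ o (X (n + 1) ω)}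
      ≤ P.real ({ω | A (n + 1) ω ≠ G (n + 1) ω} ∪ {ω | G (n + 1) ω ≠ o (X (n + 1) ω)}) :=
        measureReal_mono fun ω hω => or_iff_not_imp_left.2 fun hAG hG =>
          hω ((not_not.1 hAG).trans hG)
    _ ≤ P.real {ω | A (n + 1) ω ≠ G (n + 1) ω} + P.real {ω | G (n + 1) ω ≠ o (X (n + 1) ω)} :=
        measureReal_union_le _ _
    _ ≤ _ := add_le_add (h.measureReal_arm_ne_greedy_le (hε0 n))
        ((h.measureReal_greedy_ne_le hΦ hcell (fun x => (ho x).1) n).trans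
          (sum_le_sum fun i _ => h.measureReal_not_isAccurate_le hε0 hε1 hR hδ i n))

theorem integral_gap_le_of_eq_one_div_sqrt [Fintype 𝒳]
    (h : IsEpsGreedyRun P ℱ Φ μ p R (fun t => 1 / √(t : ℝ)) X A Y θ G) (hp : ∀ x, 0 < p x)
    (hΦ : Submodule.span ℝ (Set.range Φ.row) = ⊤) {δ : ℝ} (hδ : 0 < δ)
    (hcell : cell μ δ ⊆ robustRegion Φ) (hR : R ≠ 0) (n : ℕ) :
    ∫ ω, gap μ (X (n + 1) ω) (A (n + 1) ω) ∂P ≤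
      maxGap μ * roundConstant 𝒜 p R δ * (1 / √((n + 1 : ℕ) : ℝ)) := by
  have hε0 (k : ℕ) : 0 ≤ 1 / √((k + 1 : ℕ) : ℝ) := by positivity
  have hε1 (k : ℕ) : 1 / √((k + 1 : ℕ) : ℝ) ≤ 1 :=
    div_le_one_of_le₀ (Real.one_le_sqrt.2 (Nat.one_le_cast.2 k.succ_pos)) (Real.sqrt_nonneg _)
  rw [mul_assoc, roundConstant, add_mul, one_mul, sum_mul]
  refine (h.integral_gap_le hΦ hδ hcell hε0 hε1 hR n).trans
    (mul_le_mul_of_nonneg_left (add_le_add_right (sum_le_sum fun i _ => ?_) _) (maxGap_nonneg μ))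
  rw [mul_assoc]
  exact mul_le_mul_of_nonneg_left
    (exp_neg_mul_sum_one_div_sqrt_le (concentrationRate_pos (hp i.1) hR hδ.ne') n) zero_le_two

end Concentration

end IsEpsGreedyRun

end Run

end ContextBandit

open ContextBandit in
theorem mainTheorem5_general {𝒳 𝒜 : Type*}
    [Fintype 𝒳] [DecidableEq 𝒳] [MeasurableSpace 𝒳] [MeasurableSingletonClass 𝒳]
    [Fintype 𝒜] [DecidableEq 𝒜] [MeasurableSpace 𝒜] [MeasurableSingletonClass 𝒜]
    {p : 𝒳 → ℝ} (hp : ∀ x, 0 < p x) {R : ℝ} (hR : R ≠ 0) {d : ℕ}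
    {Φ : Matrix (𝒳 × 𝒜) (Fin d) ℝ} (hΦ : Submodule.span ℝ (Set.range Φ.row) = ⊤)
    {μ : 𝒳 × 𝒜 → ℝ} {δ : ℝ} (hδ : 0 < δ) (hcell : cell μ δ ⊆ robustRegion Φ)
    {Ω : Type*} {mΩ : MeasurableSpace Ω} {P : Measure Ω} [IsProbabilityMeasure P]
    {ℱ : Filtration ℕ mΩ} {X : ℕ → Ω → 𝒳} {A : ℕ → Ω → 𝒜} {Y : ℕ → Ω → ℝ}
    {θ : ℕ → Ω → (Fin d → ℝ)} {G : ℕ → Ω → 𝒜}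
    (h : IsEpsGreedyRun P ℱ Φ μ p R (fun t => 1 / √(t : ℝ)) X A Y θ G) (T : ℕ) :
    regret P μ X A T ≤ 2 * roundConstant 𝒜 p R δ * maxGap μ * √(T : ℝ) := by
  have hround : ∀ t ∈ Finset.Icc 1 T, ∫ ω, gap μ (X t ω) (A t ω) ∂P ≤
      maxGap μ * roundConstant 𝒜 p R δ * (1 / √(t : ℝ)) := fun t ht => by
    obtain ⟨n, rfl⟩ := Nat.exists_eq_add_of_le' (Finset.mem_Icc.1 ht).1
    exact h.integral_gap_le_of_eq_one_div_sqrt hp hΦ hδ hcell hR n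
  calc regret P μ X A T
      ≤ ∑ t ∈ Finset.Icc 1 T, maxGap μ * roundConstant 𝒜 p R δ * (1 / √(t : ℝ)) :=
        Finset.sum_le_sum hround
    _ = maxGap μ * roundConstant 𝒜 p R δ * ∑ t ∈ Finset.Icc 1 T, 1 / √(t : ℝ) :=
        (Finset.mul_sum ..).symm
    _ ≤ maxGap μ * roundConstant 𝒜 p R δ * (2 * √(T : ℝ)) :=
        mul_le_mul_of_nonneg_left (sum_one_div_sqrt_le T)
          (mul_nonneg (maxGap_nonneg μ) (roundConstant_nonneg hp hR hδ.ne'))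
    _ = 2 * roundConstant 𝒜 p R δ * maxGap μ * √(T : ℝ) := by ring

theorem mainTheorem5 {𝒳 𝒜 : Type*}
    [Fintype 𝒳] [DecidableEq 𝒳] [MeasurableSpace 𝒳] [DiscreteMeasurableSpace 𝒳]
    [Fintype 𝒜] [DecidableEq 𝒜] [MeasurableSpace 𝒜] [DiscreteMeasurableSpace 𝒜]
    (p : 𝒳 → ℝ) (hp_pos : ∀ x, 0 < p x) (hp_sum : ∑ x, p x = 1) :
    ∃ C : ℝ → ℝ,
      ∀ (d : ℕ) (Φ : Matrix (𝒳 × 𝒜) (Fin d) ℝ),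
      Submodule.span ℝ (Set.range Φ.row) = ⊤ →
      ∀ μ ∈ ContextBandit.robustInterior Φ,
      ∀ δ : ℝ, 0 < δ → ContextBandit.cell μ δ ⊆ ContextBandit.robustRegion Φ →
      ∀ (Ω : Type*) [mΩ : MeasurableSpace Ω] (P : Measure Ω) [IsProbabilityMeasure P]
        (ℱ : Filtration ℕ mΩ) (X : ℕ → Ω → 𝒳) (A : ℕ → Ω → 𝒜) (Y : ℕ → Ω → ℝ)
        (θ : ℕ → Ω → (Fin d → ℝ)) (G : ℕ → Ω → 𝒜),
        ContextBandit.IsEpsGreedyRun P ℱ Φ μ p (1 / 2) (fun t => 1 / √(t : ℝ)) X A Y θ G →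
        ∀ T : ℕ,
          ContextBandit.regret P μ X A T ≤ C δ * ContextBandit.maxGap μ * √(T : ℝ) :=
  ⟨fun δ => 2 * ContextBandit.roundConstant 𝒜 p (1 / 2) δ,
    fun _ _ hΦ _ _ _ hδ hcell _ _ _ _ _ _ _ _ _ _ h T =>
      mainTheorem5_general hp_pos (by norm_num) hΦ hδ hcell h T⟩
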